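/- For a family $\mathbf a=(a_p)_p$ of integers indexed by the primes with $0\le a_p<p$ for all $p$, and $c>0$, put \[ \mathcal A(\mathbf a,c)=\Bigl\{x\in[0,1] : \Bigl|x-\frac{a_p}{p}\Bigr|\le\frac cp \text{ for infinitely many primes } p\Bigr\},\qquad \mathcal A(\mathbf a)=\bigcap_{c>0}\mathcal A(\mathbf a,c). \] For a prime $p_0$ consider the following procedure $\mathrm{CoverOnceFrom}(p_0)$: start with $q:=p_0-1$ and $x:=0$; as long as $x<1$, replace $q$ by the smallest prime strictly larger than $q$, set $a_q:=\lfloor qx\rfloor$ (with the current value of $x$), and replace $x$ by $\frac{a_q}{q}+\frac 2q$. The greedy algorithm runs $\mathrm{CoverOnceFrom}(2)$ and then, whenever a run has ended with last prime $q$, runs $\mathrm{CoverOnceFrom}(q')$, where $q'$ is the smallest prime larger than $q$. Let $\mathbf g=(g_p)_p$ be the sequence of all the integers $g_p:=a_p$ assigned in this way. Theorem. For every prime $p_0$ the procedure $\mathrm{CoverOnceFrom}(p_0)$ terminates, and the sequence $\mathbf g$ satisfies $0\le g_p<p$ for all primes $p$. Moreover: 1. $\mathcal A(\mathbf g,c)=[0,1]$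 for every real $c>2$; 2. $\lambda(\mathcal A(\mathbf g))=1$, where $\lambda$ is Lebesgue measure; 3. $\dim_H\bigl([0,1]\setminus\mathcal A(\mathbf g,c)\bigr)=1$ for every real $c$ with $0<c<1/60$, where $\dim_H$ is the Hausdorff dimension. -/

import Mathlib

namespace PrimeApprox

/-- The space `Ω` of families `(a_p)_p` of integers, indexed by the primes, with `0 ≤ a_p < p`. -/
def Omega : Set (Nat.Primes → ℤ) :=
  {a | ∀ p : Nat.Primes, 0 ≤ a p ∧ a p < (p : ℤ)}

/-- `𝒜(a, c)`: the `x ∈ [0,1]` such that `|x - a_p / p| ≤ c / p` for infinitely many primes `p`. -/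
def approxSetWith (a : Nat.Primes → ℤ) (c : ℝ) : Set ℝ :=
  {x | x ∈ Set.Icc (0 : ℝ) 1 ∧
    {p : Nat.Primes | |x - (a p : ℝ) / (p : ℝ)| ≤ c / (p : ℝ)}.Infinite}

/-- `𝒜(a)`: the intersection of all the sets `𝒜(a, c)` with `c > 0`. -/
def approxSet (a : Nat.Primes → ℤ) : Set ℝ :=
  ⋂ (c : ℝ) (_ : 0 < c), approxSetWith a c

/-- The smallest prime number strictly larger than `n`. -/
def nextPrime (n : ℕ) : ℕ :=
  Nat.find (Nat.exists_infinite_primes (n + 1))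

/-- The variables of the covering procedure: the current prime `q`, the integer `a = a_q` that was
assigned in the last pass through the loop, and the rational number `x` up to which the unit
interval has been covered. -/
structure CoverState where
  q : ℕ
  a : ℤ
  x : ℚ

/-- Initialization of the procedure CoverOnceFrom(`p₀`): `q ← p₀ - 1`, `x ← 0`
(the value of `a` is a placeholder, never used). -/
def coverInit (p₀ : ℕ) : CoverState := ⟨p₀ - 1, 0, 0⟩

/-- The body of the while loop:
`q ← nextPrime q`, then `a_q := ⌊q x⌋`, then `x ← a_q / q + 2 / q`. -/
def coverBody (s : CoverState) : CoverState where
  q := nextPrime s.q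
  a := ⌊(nextPrime s.q : ℚ) * s.x⌋
  x := (⌊(nextPrime s.q : ℚ) * s.x⌋ : ℚ) / (nextPrime s.q : ℚ) + 2 / (nextPrime s.q : ℚ)

/-- The run of CoverOnceFrom(`p₀`) (`while x < 1 do body`) terminates: the loop condition `x < 1`
fails after finitely many passes. -/
def CoverTerminates (p₀ : ℕ) : Prop :=
  ∃ k : ℕ, ¬ (coverBody^[k] (coverInit p₀)).x < 1

/-- The greedy algorithm: CoverOnceFrom is run starting from the prime `2`, and whenever a run has
ended (with last prime `q`), it is called again with starting prime `nextPrime q`.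
`greedyState n` holds the variables after a total of `n` passes through the loop body. -/
def greedyState : ℕ → CoverState
  | 0 => coverInit 2
  | n + 1 =>
    let s := greedyState n
    if s.x < 1 then coverBody s else coverBody (coverInit (nextPrime s.q))

theorem nextPrime_prime (n : ℕ) : (nextPrime n).Prime :=
  (Nat.find_spec (Nat.exists_infinite_primes (n + 1))).2

theorem lt_nextPrime (n : ℕ) : n < nextPrime n :=
  (Nat.find_spec (Nat.exists_infinite_primes (n + 1))).1

theorem nextPrime_le {n p : ℕ} (hp : p.Prime) (h : n < p) : nextPrime n ≤ p :=
  Nat.find_min' _ ⟨h, hp⟩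

theorem nextPrime_pred {p : ℕ} (hp : p.Prime) : nextPrime (p - 1) = p := by
  have h1 := nextPrime_le hp (Nat.sub_lt hp.pos one_pos)
  have h2 := lt_nextPrime (p - 1)
  omega

theorem greedyState_succ_q (n : ℕ) :
    (greedyState (n + 1)).q = nextPrime (greedyState n).q := by
  simp only [greedyState]
  split_ifs
  · rfl
  · exact nextPrime_pred (nextPrime_prime _)

/-- The `(n+1)`-st pass through the loop body treats the prime with index `n`. -/
theorem greedyState_q (n : ℕ) : (greedyState (n + 1)).q = Nat.nth Nat.Prime n := by
  induction n with
  | zero =>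
    rw [greedyState_succ_q, Nat.nth_prime_zero_eq_two]
    exact nextPrime_pred Nat.prime_two
  | succ n ih =>
    rw [greedyState_succ_q, ih]
    apply le_antisymm
    · exact nextPrime_le (Nat.prime_nth_prime _)
        (Nat.nth_strictMono Nat.infinite_setOfPred_prime (Nat.lt_succ_self n))
    · have h := lt_nextPrime (Nat.nth Nat.Prime n)
      rw [← Nat.nth_count (nextPrime_prime (Nat.nth Nat.Prime n))] at h ⊢
      rw [Nat.nth_lt_nth Nat.infinite_setOfPred_prime] at h
      exact (Nat.nth_le_nth Nat.infinite_setOfPred_prime).2 h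

/-- The greedy sequence `g`: the value `g_p` is the integer assigned in the pass of the greedy
algorithm that treats the prime `p` (this is the pass that follows those treating the primes
smaller than `p`). -/
def greedySeq (p : Nat.Primes) : ℤ :=
  (greedyState (Nat.primeCounting' p + 1)).a

/-- In the pass that defines `g_p`, the variable `q` is `p`. -/
theorem greedyState_primeCounting (p : Nat.Primes) :
    (greedyState (Nat.primeCounting' p + 1)).q = p := by
  rw [greedyState_q]
  exact Nat.nth_count p.2

end PrimeApprox

/-!
Each pass of the greedy algorithm, treating the prime `p`, moves the covered length `x` forward by
at least `1 / p` and at most `2 / p`. As the sum of the reciprocals of the primes diverges, every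
run ends, and there are infinitely many of them. A run covers `[0, 1]` by the intervals
`[g_p / p, g_p / p + 2 / p]`, so every point lies in infinitely many of these; this gives the
statement on `c > 2`. Multiplying the radii of a sequence of balls by a constant changes the
limsup set only by a null set (`blimsup_cthickening_mul_ae_eq`, after Cassels), so each
`approxSetWith greedySeq c` with `c > 0` has full measure in `[0, 1]`, and so has their countable
intersection.

For the dimension of the exceptional set, fix `N` and put `M = 20 N`. Consider the intervals of
length `1 / (10 Q)`, `Q = P * M ^ n`, that avoid the `1 / (60 p)`-neighbourhoods of the centres
`g_p / p` for all primes `p` in `(P, Q]`. Such an interval contains `N` separated intervals of the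
next level, `1 / M` times as long (`card_filter_avoid_ge`). Indeed, only the primes in `(Q, M Q]`
are new. Since the primes have density zero, the sum of their reciprocals is small when `P` is
large, so only one run visits the given interval while these primes are treated
(`center_sub_center`). The centres of one run are spaced by at least `1 / p`, hence the
neighbourhoods of radius `1 / (60 p)` spoil only a fraction of the candidates. The Cantor set so
obtained has dimension at least `log N / log (20 N)` (`log_div_log_le_dimH`), which tends to `1`
as `N` grows.
-/

open Filter Topology MeasureTheory Set

namespace PrimeApprox

/-! ### The greedy algorithm, indexed by the passes through its loop -/

/-- The `n`-th prime number, counted from `0`: the prime treated in the pass with index `n`. -/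
noncomputable abbrev nthPrime (n : ℕ) : ℕ := Nat.nth Nat.Prime n

/-- The centre `g_p / p` belonging to the `n`-th prime `p`. -/
noncomputable def center (n : ℕ) : ℝ := ((greedyState (n + 1)).a : ℝ) / (nthPrime n : ℝ)

/-- The point up to which the current run has covered the unit interval before the pass with
index `n`; a value at least `1` means that this pass starts a new run. -/
noncomputable def covered (n : ℕ) : ℝ := ((greedyState n).x : ℝ)

theorem nthPrime_pos (n : ℕ) : (0 : ℝ) < nthPrime n := by
  exact_mod_cast (Nat.prime_nth_prime n).pos

theorem nthPrime_strictMono : StrictMono nthPrime :=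
  Nat.nth_strictMono Nat.infinite_setOfPred_prime

theorem nthPrime_succ (n : ℕ) : nthPrime (n + 1) = nextPrime (nthPrime n) := by
  have h := greedyState_succ_q (n + 1)
  rwa [greedyState_q, greedyState_q] at h

/-- The state from which the loop body is executed in the pass with index `n`. -/
theorem greedyState_succ_eq_coverBody (n : ℕ) : ∃ e : CoverState,
    greedyState (n + 1) = coverBody e ∧ nextPrime e.q = nthPrime n ∧
      e.x = if (greedyState n).x < 1 then (greedyState n).x else 0 := by
  refine ⟨if (greedyState n).x < 1 then greedyState n
    else coverInit (nextPrime (greedyState n).q), ?_, ?_, ?_⟩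
  · simp only [greedyState]
    split_ifs <;> rfl
  · rw [nthPrime, ← greedyState_q n, greedyState_succ_q]
    split_ifs with h
    · rfl
    · exact nextPrime_pred (nextPrime_prime _)
  · split_ifs <;> rfl

theorem coverBody_x_bounds (s : CoverState) :
    s.x + 1 / nextPrime s.q ≤ (coverBody s).x ∧ (coverBody s).x ≤ s.x + 2 / nextPrime s.q := by
  have hq : (0 : ℚ) < nextPrime s.q := by exact_mod_cast (nextPrime_prime s.q).pos
  have h1 := Int.floor_le ((nextPrime s.q : ℚ) * s.x)
  have h2 := Int.lt_floor_add_one ((nextPrime s.q : ℚ) * s.x)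
  simp only [coverBody]
  constructor
  · rw [← add_div, le_div_iff₀ hq, add_mul, div_mul_cancel₀ _ hq.ne']
    nlinarith
  · gcongr
    rw [div_le_iff₀ hq]
    nlinarith

theorem covered_succ (n : ℕ) : covered (n + 1) = center n + 2 / nthPrime n := by
  obtain ⟨e, h1, h2, -⟩ := greedyState_succ_eq_coverBody n
  simp only [covered, center, h1, coverBody, h2]
  push_cast
  ring

/-- The integer assigned in a pass is a floor: of `p` times the covered length if the pass
continues a run, and of `0` if it starts one. -/
theorem greedyState_succ_a (n : ℕ) : (greedyState (n + 1)).a =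
    ⌊(nthPrime n : ℚ) * if (greedyState n).x < 1 then (greedyState n).x else 0⌋ := by
  obtain ⟨e, h1, h2, h3⟩ := greedyState_succ_eq_coverBody n
  rw [h1, ← h3, ← h2]
  rfl

theorem center_eq_zero {n : ℕ} (h : 1 ≤ covered n) : center n = 0 := by
  have h' : ¬ (greedyState n).x < 1 := by
    rw [not_lt]; unfold covered at h; exact_mod_cast h
  simp [center, greedyState_succ_a, h']

theorem center_le_covered {n : ℕ} (h : covered n < 1) : center n ≤ covered n := by
  have h' : (greedyState n).x < 1 := by unfold covered at h; exact_mod_cast h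
  rw [center, greedyState_succ_a, if_pos h', div_le_iff₀ (nthPrime_pos n), mul_comm (covered n)]
  have := Int.floor_le ((nthPrime n : ℚ) * (greedyState n).x)
  unfold covered
  exact_mod_cast this

theorem covered_lt_center_add {n : ℕ} (h : covered n < 1) :
    covered n < center n + 1 / nthPrime n := by
  have h' : (greedyState n).x < 1 := by unfold covered at h; exact_mod_cast h
  rw [center, greedyState_succ_a, if_pos h', ← add_div, lt_div_iff₀ (nthPrime_pos n), mul_comm]
  have := Int.lt_floor_add_one ((nthPrime n : ℚ) * (greedyState n).x)
  unfold covered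
  exact_mod_cast this

theorem greedyState_x_nonneg (n : ℕ) : 0 ≤ (greedyState n).x := by
  induction n with
  | zero => exact le_rfl
  | succ n ih =>
    obtain ⟨e, h1, -, h3⟩ := greedyState_succ_eq_coverBody n
    have he : 0 ≤ e.x := by rw [h3]; split_ifs <;> simp [ih]
    have := (coverBody_x_bounds e).1
    rw [h1]
    refine le_trans ?_ this
    positivity

theorem greedyState_succ_a_bounds (n : ℕ) :
    0 ≤ (greedyState (n + 1)).a ∧ (greedyState (n + 1)).a < nthPrime n := by
  have hp : (0 : ℚ) < nthPrime n := by exact_mod_cast (Nat.prime_nth_prime n).pos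
  have hx := greedyState_x_nonneg n
  rw [greedyState_succ_a]
  constructor
  · apply Int.floor_nonneg.2
    split_ifs <;> positivity
  · rw [Int.floor_lt]
    split_ifs with h
    · push_cast
      nlinarith
    · simpa using hp

theorem center_nonneg (n : ℕ) : 0 ≤ center n :=
  div_nonneg (by exact_mod_cast (greedyState_succ_a_bounds n).1) (nthPrime_pos n).le

theorem greedySeq_mem_Omega : greedySeq ∈ Omega := by
  intro p
  have h := greedyState_succ_a_bounds (Nat.primeCounting' p)
  have hp : nthPrime (Nat.primeCounting' p) = p := Nat.nth_count p.2
  rwa [hp] at h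

/-! ### Termination -/

theorem coverBody_iterate_q (s : CoverState) {i : ℕ} (hs : nextPrime s.q = nthPrime i) (k : ℕ) :
    nextPrime (coverBody^[k] s).q = nthPrime (i + k) := by
  induction k with
  | zero => exact hs
  | succ k ih => rw [Function.iterate_succ_apply', ← add_assoc, nthPrime_succ, ← ih]; rfl

theorem not_summable_one_div_nthPrime (i : ℕ) :
    ¬ Summable fun k : ℕ => 1 / (nthPrime (i + k) : ℝ) := by
  intro h
  have h1 : Summable fun k : ℕ => 1 / (nthPrime k : ℝ) := by
    rw [← summable_nat_add_iff i]
    simpa only [add_comm] using h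
  refine Nat.Primes.not_summable_one_div ?_
  have hinj : Function.Injective fun p : Nat.Primes => Nat.primeCounting' p := by
    intro p q hpq
    have hp : nthPrime (Nat.primeCounting' p) = p := Nat.nth_count p.2
    have hq : nthPrime (Nat.primeCounting' q) = q := Nat.nth_count q.2
    apply Subtype.ext
    rw [← hp, ← hq]
    exact congrArg nthPrime hpq
  refine (h1.comp_injective hinj).congr fun p => ?_
  have hp : nthPrime (Nat.primeCounting' p) = p := Nat.nth_count p.2
  simp only [Function.comp_apply, hp]

/-- Every pass covers at least `1 / p` more, and the sum of the reciprocals of the primes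
diverges. -/
theorem exists_iterate_coverBody_x_ge (s : CoverState) (h0 : 0 ≤ s.x) {i : ℕ}
    (hs : nextPrime s.q = nthPrime i) : ∃ k : ℕ, ¬ (coverBody^[k] s).x < 1 := by
  by_contra! hlt
  have hsum : ∀ k, ∑ j ∈ Finset.range k, 1 / (nthPrime (i + j) : ℝ) ≤ (coverBody^[k] s).x := by
    intro k
    induction k with
    | zero => simpa using h0
    | succ k ih =>
      have h := (coverBody_x_bounds (coverBody^[k] s)).1
      rw [coverBody_iterate_q s hs] at h
      have h' : (((coverBody^[k] s).x : ℚ) : ℝ) + 1 / (nthPrime (i + k) : ℝ)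
          ≤ ((coverBody (coverBody^[k] s)).x : ℚ) := by
        have h2 := (Rat.cast_le (K := ℝ)).2 h
        push_cast at h2
        exact h2
      rw [Finset.sum_range_succ, Function.iterate_succ_apply']
      linarith
  refine not_summable_one_div_nthPrime i (summable_of_sum_range_le (c := 1)
    (fun k => by positivity) fun k => (hsum k).trans ?_)
  exact_mod_cast (hlt k).le

theorem coverTerminates {p₀ : ℕ} (hp : p₀.Prime) : CoverTerminates p₀ := by
  refine exists_iterate_coverBody_x_ge (coverInit p₀) le_rfl (i := Nat.primeCounting' p₀) ?_
  have h : nthPrime (Nat.primeCounting' p₀) = p₀ := Nat.nth_count hp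
  rw [h]
  exact nextPrime_pred hp

/-- Infinitely many runs are started. -/
theorem exists_ge_one_le_covered (n : ℕ) : ∃ m, n ≤ m ∧ 1 ≤ covered m := by
  by_contra! hlt
  have hx : ∀ k, (greedyState (n + k)).x < 1 := fun k => by
    have := hlt (n + k) (Nat.le_add_right _ _)
    unfold covered at this
    exact_mod_cast this
  have hit : ∀ k, coverBody^[k] (greedyState n) = greedyState (n + k) := by
    intro k
    induction k with
    | zero => rfl
    | succ k ih =>
      rw [Function.iterate_succ_apply', ih, ← add_assoc]
      simp only [greedyState, if_pos (hx k)]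
  have hq : nextPrime (greedyState n).q = nthPrime n := by
    rw [← greedyState_succ_q, greedyState_q]
  obtain ⟨k, hk⟩ := exists_iterate_coverBody_x_ge _ (greedyState_x_nonneg n) hq
  rw [hit] at hk
  exact hk (hx k)

/-! ### The covering property -/

theorem mem_approxSetWith_greedySeq {c x : ℝ} : x ∈ approxSetWith greedySeq c ↔
    x ∈ Icc (0 : ℝ) 1 ∧ ∃ᶠ n in atTop, |x - center n| ≤ c / nthPrime n := by
  let φ : ℕ → Nat.Primes := fun n => ⟨nthPrime n, Nat.prime_nth_prime n⟩
  have hinj : Function.Injective φ := fun m n h =>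
    nthPrime_strictMono.injective (congrArg Subtype.val h)
  have hsurj : Function.Surjective φ := fun p =>
    ⟨Nat.primeCounting' p, Subtype.ext (Nat.nth_count p.2)⟩
  have hφ : ∀ n, (greedySeq (φ n) : ℝ) / ((φ n : ℕ) : ℝ) = center n := by
    intro n
    simp only [greedySeq, center, φ, Nat.primeCounting'_nth_eq]
  rw [approxSetWith, mem_ofPred_eq, Nat.frequently_atTop_iff_infinite]
  refine and_congr_right fun _ => ?_
  rw [← Set.infinite_image_iff hinj.injOn]
  have : {p : Nat.Primes | |x - (greedySeq p : ℝ) / (p : ℝ)| ≤ c / (p : ℝ)} =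
      φ '' {n | |x - center n| ≤ c / nthPrime n} := by
    ext p
    obtain ⟨n, rfl⟩ := hsurj p
    rw [hinj.mem_set_image, mem_ofPred_eq, mem_ofPred_eq, hφ]
  rw [this]

/-- Every complete run meets every point of the unit interval: the point lies in the interval
`[center n, center n + 2 / nthPrime n]` of the first pass that moves past it. -/
theorem frequently_abs_sub_center_le {y : ℝ} (hy : y ∈ Icc (0 : ℝ) 1) :
    ∃ᶠ n in atTop, |y - center n| ≤ 2 / nthPrime n := by
  rw [frequently_atTop]
  intro n₀
  obtain ⟨m, hm, hm1⟩ := exists_ge_one_le_covered n₀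
  obtain ⟨m', hm', hm1'⟩ := exists_ge_one_le_covered (m + 1)
  have hex : ∃ k, y ≤ covered (m + k + 1) :=
    ⟨m' - (m + 1), by rw [show m + (m' - (m + 1)) + 1 = m' by omega]; exact hy.2.trans hm1'⟩
  classical
  let k := Nat.find hex
  have hk : y ≤ center (m + k) + 2 / nthPrime (m + k) := by
    rw [← covered_succ]; exact Nat.find_spec hex
  have hle : center (m + k) ≤ y := by
    rcases Nat.eq_zero_or_pos k with h | h
    · rw [h, add_zero, center_eq_zero hm1]
      exact hy.1
    · have hlt := Nat.find_min hex (show k - 1 < k by omega)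
      rw [show m + (k - 1) + 1 = m + k by omega, not_le] at hlt
      exact (center_le_covered (hlt.trans_le hy.2)).trans hlt.le
  refine ⟨m + k, by omega, ?_⟩
  rw [abs_of_nonneg (by linarith)]
  linarith

theorem approxSetWith_greedySeq_eq_Icc {c : ℝ} (hc : 2 ≤ c) :
    approxSetWith greedySeq c = Icc (0 : ℝ) 1 := by
  ext y
  rw [mem_approxSetWith_greedySeq, and_iff_left_iff_imp]
  intro hy
  refine (frequently_abs_sub_center_le hy).mono fun n hn => hn.trans ?_
  gcongr

/-! ### Full measure -/

theorem tendsto_div_nthPrime (c : ℝ) : Tendsto (fun n => c / (nthPrime n : ℝ)) atTop (𝓝 0) :=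
  tendsto_const_nhds.div_atTop
    (tendsto_natCast_atTop_atTop.comp nthPrime_strictMono.tendsto_atTop)

theorem approxSetWith_greedySeq_eq_inter_blimsup {c : ℝ} (hc : 0 ≤ c) :
    approxSetWith greedySeq c = Icc (0 : ℝ) 1 ∩
      blimsup (fun n => Metric.cthickening (c / nthPrime n) {center n}) atTop fun _ => True := by
  ext y
  rw [mem_approxSetWith_greedySeq, mem_inter_iff, blimsup_true, mem_limsup_iff_frequently_mem]
  refine and_congr_right fun _ => frequently_congr (Eventually.of_forall fun n => ?_)
  rw [Metric.cthickening_singleton _ (by positivity), Metric.mem_closedBall, Real.dist_eq]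

theorem approxSetWith_greedySeq_ae_eq {c : ℝ} (hc : 0 < c) :
    approxSetWith greedySeq c =ᵐ[volume] Icc (0 : ℝ) 1 := by
  have h := blimsup_cthickening_mul_ae_eq volume (fun _ => True) (fun n => {center n})
    (half_pos hc) (fun n => 2 / (nthPrime n : ℝ)) (tendsto_div_nthPrime 2)
  have hmul : ∀ n, c / 2 * (2 / (nthPrime n : ℝ)) = c / nthPrime n := fun n => by ring
  simp only [hmul] at h
  rw [← approxSetWith_greedySeq_eq_Icc le_rfl, approxSetWith_greedySeq_eq_inter_blimsup hc.le,
    approxSetWith_greedySeq_eq_inter_blimsup zero_le_two]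
  exact (ae_eq_refl _).inter h

theorem approxSetWith_mono (a : Nat.Primes → ℤ) {c c' : ℝ} (h : c ≤ c') :
    approxSetWith a c ⊆ approxSetWith a c' := fun x hx =>
  ⟨hx.1, hx.2.mono fun p (hp : |x - (a p : ℝ) / (p : ℝ)| ≤ c / (p : ℝ)) =>
    show |x - (a p : ℝ) / (p : ℝ)| ≤ c' / (p : ℝ) from hp.trans (by gcongr)⟩

theorem volume_approxSet_greedySeq : volume (approxSet greedySeq) = 1 := by
  have h : approxSet greedySeq = ⋂ n : ℕ, approxSetWith greedySeq (1 / ((n : ℝ) + 1)) := by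
    ext x
    simp only [approxSet, mem_iInter]
    refine ⟨fun hx n => hx _ (by positivity), fun hx c hc => ?_⟩
    obtain ⟨n, hn⟩ := exists_nat_one_div_lt hc
    exact approxSetWith_mono _ hn.le (hx n)
  have hae : approxSet greedySeq =ᵐ[volume] Icc (0 : ℝ) 1 := by
    rw [h]
    have := Filter.EventuallyEq.countable_iInter (l := ae volume)
      fun n : ℕ => approxSetWith_greedySeq_ae_eq (c := 1 / ((n : ℝ) + 1)) (by positivity)
    rwa [iInter_const] at this
  rw [measure_congr hae]
  simp

/-! ### A lower bound for the Hausdorff dimension of Cantor sets -/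

section CantorTree

variable {N : ℕ} (child : ℕ → ℝ → Fin N → ℝ) (t₀ : ℝ)

/-- The left end point of the interval of level `n` that is reached from `t₀` along the branch
`d`; `child n t i` is the left end point of the `i`-th child of the interval of level `n` that
starts at `t`. -/
noncomputable def cantorNode (d : ℕ → Fin N) : ℕ → ℝ
  | 0 => t₀
  | n + 1 => child n (cantorNode d n) (d n)

/-- The point that the nested intervals along the branch `d` converge to. -/
noncomputable def cantorPoint (d : ℕ → Fin N) : ℝ := ⨆ n, cantorNode child t₀ d n

variable {child t₀}

theorem cantorNode_congr {d e : ℕ → Fin N} {n : ℕ} (h : ∀ i < n, d i = e i) :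
    cantorNode child t₀ d n = cantorNode child t₀ e n := by
  induction n with
  | zero => rfl
  | succ n ih =>
    rw [cantorNode, cantorNode, ih fun i hi => h i (by omega), h n n.lt_succ_self]

theorem cantorNode_good {Good : ℕ → ℝ → Prop} (h0 : Good 0 t₀)
    (hchild : ∀ n t, Good n t → ∀ i, Good (n + 1) (child n t i)) (d : ℕ → Fin N) (n : ℕ) :
    Good n (cantorNode child t₀ d n) := by
  induction n with
  | zero => exact h0
  | succ n ih => exact hchild n _ ih _

theorem cantorPoint_mem_Icc {ℓ : ℕ → ℝ} (hℓ : ∀ n, 0 ≤ ℓ n) {d : ℕ → Fin N}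
    (hle : ∀ n, cantorNode child t₀ d n ≤ cantorNode child t₀ d (n + 1))
    (hadd : ∀ n, cantorNode child t₀ d (n + 1) + ℓ (n + 1) ≤ cantorNode child t₀ d n + ℓ n)
    (n : ℕ) :
    cantorPoint child t₀ d ∈
      Icc (cantorNode child t₀ d n) (cantorNode child t₀ d n + ℓ n) := by
  have hmono := monotone_nat_of_le_succ hle
  have hanti : Antitone fun n => cantorNode child t₀ d n + ℓ n := antitone_nat_of_succ_le hadd
  have hub : ∀ n m, cantorNode child t₀ d m ≤ cantorNode child t₀ d n + ℓ n := fun n m => by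
    have h1 := hmono (le_max_left m n)
    have h2 := hanti (le_max_right m n)
    have h3 := hℓ (max m n)
    simp only at h2
    linarith
  exact ⟨le_ciSup ⟨_, by rintro _ ⟨m, rfl⟩; exact hub n m⟩ n, ciSup_le (hub n)⟩

end CantorTree

/-- If every good interval of level `n`, of length `ℓ₀ / M ^ n`, contains `N` good intervals of
level `n + 1` that are separated by at least their own length, then the set of the points lying in
good intervals of all levels has Hausdorff dimension at least `log N / log M`. The map that sends
a point of the resulting Cantor set to the real number whose base-`N` digits are the branches
chosen is Hölder continuous with this exponent and maps onto `[0, 1]`. -/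
theorem log_div_log_le_dimH {N M : ℕ} (hN : 2 ≤ N) (hNM : N ≤ M) {ℓ₀ : ℝ} (hℓ₀ : 0 < ℓ₀)
    {Good : ℕ → ℝ → Prop} {t₀ : ℝ} (h0 : Good 0 t₀)
    (hGood : ∀ n t, Good n t → ∃ f : Fin N → ℝ, ∀ i, Good (n + 1) (f i) ∧ t ≤ f i ∧
      f i + ℓ₀ / M ^ (n + 1) ≤ t + ℓ₀ / M ^ n ∧
      ∀ j, i ≠ j → 2 * (ℓ₀ / M ^ (n + 1)) ≤ |f i - f j|)
    {K : Set ℝ} (hK : ∀ x, (∀ n, ∃ t, Good n t ∧ x ∈ Icc t (t + ℓ₀ / M ^ n)) → x ∈ K) :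
    ENNReal.ofReal (Real.log N / Real.log M) ≤ dimH K := by
  classical
  have hN1 : (1 : ℝ) < N := by exact_mod_cast hN
  have hM1 : (1 : ℝ) < M := by exact_mod_cast hN.trans hNM
  have hM0 : (0 : ℝ) < M := by linarith
  have hlogM := Real.log_pos hM1
  set s : ℝ := Real.log N / Real.log M with hs
  have hs0 : 0 < s := div_pos (Real.log_pos hN1) hlogM
  set ℓ : ℕ → ℝ := fun n => ℓ₀ / M ^ n with hℓ
  have hℓpos : ∀ n, 0 < ℓ n := fun n => by positivity
  let child : ℕ → ℝ → Fin N → ℝ := fun n t i =>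
    if h : Good n t then (hGood n t h).choose i else t
  have hchild : ∀ n t, Good n t → ∀ i, Good (n + 1) (child n t i) ∧ t ≤ child n t i ∧
      child n t i + ℓ (n + 1) ≤ t + ℓ n ∧
      ∀ j, i ≠ j → 2 * ℓ (n + 1) ≤ |child n t i - child n t j| := by
    intro n t h
    simp only [child, dif_pos h]
    exact (hGood n t h).choose_spec
  have hnode := cantorNode_good h0 fun n t h i => (hchild n t h i).1
  have hmem : ∀ d n, cantorPoint child t₀ d ∈
      Icc (cantorNode child t₀ d n) (cantorNode child t₀ d n + ℓ n) := fun d =>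
    cantorPoint_mem_Icc (fun n => (hℓpos n).le)
      (fun n => (hchild n _ (hnode d n) (d n)).2.1)
      (fun n => (hchild n _ (hnode d n) (d n)).2.2.1)
  -- Branches that agree below level `n` and differ there lead to points at distance `≥ ℓ (n + 1)`.
  have hsep : ∀ d e : ℕ → Fin N, ∀ n, (∀ i < n, d i = e i) → d n ≠ e n →
      ℓ (n + 1) ≤ |cantorPoint child t₀ d - cantorPoint child t₀ e| := by
    intro d e n heq hne
    have h1 := hmem d (n + 1)
    have h2 := hmem e (n + 1)
    have h3 := (hchild n _ (hnode d n) (d n)).2.2.2 (e n) hne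
    have h4 : child n (cantorNode child t₀ d n) (e n) = cantorNode child t₀ e (n + 1) := by
      rw [cantorNode_congr heq]; rfl
    rw [h4] at h3
    change _ ≤ |cantorNode child t₀ d (n + 1) - _| at h3
    rw [mem_Icc] at h1 h2
    rcases le_abs.1 h3 with h | h
    · exact le_abs.2 (Or.inl (by linarith))
    · exact le_abs.2 (Or.inr (by linarith))
  have hfirst : ∀ d e : ℕ → Fin N, d ≠ e → ∃ n, (∀ i < n, d i = e i) ∧ d n ≠ e n := by
    intro d e hne
    have hex := Function.ne_iff.1 hne
    exact ⟨Nat.find hex, fun i hi => not_not.1 (Nat.find_min hex hi), Nat.find_spec hex⟩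
  have hinj : Function.Injective (cantorPoint child t₀) := by
    intro d e h
    by_contra hne
    obtain ⟨n, h1, h2⟩ := hfirst d e hne
    have h3 := hsep d e n h1 h2
    rw [h, sub_self, abs_zero] at h3
    exact (hℓpos _).not_ge h3
  have hpow : ∀ n : ℕ, ((N : ℝ) ^ n)⁻¹ = (M / ℓ₀ : ℝ) ^ s * ℓ (n + 1) ^ s := by
    intro n
    have h1 : (M : ℝ) ^ s = N := by
      rw [Real.rpow_def_of_pos hM0, hs, mul_div_cancel₀ _ hlogM.ne',
        Real.exp_log (by linarith)]
    rw [← Real.mul_rpow (by positivity) (hℓpos _).le]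
    have h2 : (M / ℓ₀ : ℝ) * ℓ (n + 1) = ((M : ℝ) ^ n)⁻¹ := by
      simp only [hℓ]; field_simp; ring
    rw [h2, Real.inv_rpow (by positivity), ← Real.rpow_natCast, ← Real.rpow_natCast,
      ← Real.rpow_mul hM0.le, mul_comm (n : ℝ) s, Real.rpow_mul hM0.le, h1]
  have : Nonempty (ℕ → Fin N) := ⟨fun _ => ⟨0, by omega⟩⟩
  let F : ℝ → ℝ := fun x => Real.ofDigits (Function.invFun (cantorPoint child t₀) x)
  have hF : ∀ d, F (cantorPoint child t₀ d) = Real.ofDigits d := fun d => by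
    simp only [F, Function.leftInverse_invFun hinj d]
  have hHolder : HolderOnWith (Real.toNNReal ((M / ℓ₀ : ℝ) ^ s)) (Real.toNNReal s) F
      (range (cantorPoint child t₀)) := by
    rintro _ ⟨d, rfl⟩ _ ⟨e, rfl⟩
    rw [hF, hF]
    rcases eq_or_ne d e with rfl | hne
    · simp
    obtain ⟨n, h1, h2⟩ := hfirst d e hne
    have h3 := hsep d e n h1 h2
    have h4 := Real.abs_ofDigits_sub_ofDigits_le h1
    rw [edist_dist, edist_dist, Real.dist_eq, Real.dist_eq, Real.coe_toNNReal _ hs0.le,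
      ENNReal.ofReal_rpow_of_nonneg (abs_nonneg _) hs0.le]
    change _ ≤ ENNReal.ofReal _ * _
    rw [← ENNReal.ofReal_mul (by positivity)]
    apply ENNReal.ofReal_le_ofReal
    rw [hpow] at h4
    refine h4.trans ?_
    have := hℓpos (n + 1)
    gcongr
  have himage : F '' range (cantorPoint child t₀) ⊇ Icc (0 : ℝ) 1 := by
    intro y hy
    obtain ⟨d, -, rfl⟩ := Real.ofDigits_SurjOn (show 1 < N by omega) hy
    exact ⟨_, ⟨d, rfl⟩, hF d⟩
  have hdimIcc : dimH (Icc (0 : ℝ) 1) = 1 := by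
    rw [Real.dimH_of_nonempty_interior (by rw [interior_Icc]; exact nonempty_Ioo.2 one_pos)]
    simp
  have hdim := hHolder.dimH_image_le (Real.toNNReal_pos.2 hs0)
  have h1 : 1 ≤ dimH (range (cantorPoint child t₀)) / (Real.toNNReal s : ENNReal) :=
    hdimIcc.symm.le.trans ((dimH_mono himage).trans hdim)
  rw [ENNReal.le_div_iff_mul_le (Or.inl (by simpa using hs0)) (Or.inl ENNReal.coe_ne_top),
    one_mul] at h1
  refine h1.trans (dimH_mono ?_)
  rintro _ ⟨d, rfl⟩
  exact hK _ fun n => ⟨_, hnode d n, hmem d n⟩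

/-! ### The spacing of the centres -/

/-- A pass either moves the centre to the right by an amount between `1 / p` and `2 / p`, or starts
a new run at `0`, the previous centre being within `2 / p` of `1`. -/
theorem center_succ (n : ℕ) :
    (1 / (nthPrime n : ℝ) ≤ center (n + 1) - center n ∧
      center (n + 1) - center n ≤ 2 / nthPrime n) ∨
    (center (n + 1) = 0 ∧ 1 ≤ center n + 2 / nthPrime n) := by
  have h := covered_succ n
  rcases lt_or_ge (covered (n + 1)) 1 with hlt | hge
  · have h1 := center_le_covered hlt
    have h2 := covered_lt_center_add hlt
    have h3 : 1 / (nthPrime (n + 1) : ℝ) ≤ 1 / nthPrime n :=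
      one_div_le_one_div_of_le (nthPrime_pos n)
        (by exact_mod_cast (nthPrime_strictMono n.lt_succ_self).le)
    have h4 : 2 / (nthPrime n : ℝ) = 1 / nthPrime n + 1 / nthPrime n := by ring
    exact Or.inl ⟨by linarith, by linarith⟩
  · exact Or.inr ⟨center_eq_zero hge, by linarith⟩

/-- Between two passes of the same run the centre has moved to the right by at least the sum of the
reciprocals of the primes treated in between (and by at most twice that sum); between passes of
different runs twice that sum makes up for the jump back from `1` to `0`. -/
theorem center_sub_center {i j : ℕ} (hij : i ≤ j) :
    (∑ k ∈ Finset.Ico i j, 1 / (nthPrime k : ℝ) ≤ center j - center i ∧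
      center j - center i ≤ 2 * ∑ k ∈ Finset.Ico i j, 1 / (nthPrime k : ℝ)) ∨
    center j - center i ≤ 2 * ∑ k ∈ Finset.Ico i j, 1 / (nthPrime k : ℝ) - 1 := by
  induction j, hij using Nat.le_induction with
  | base => left; simp
  | succ j hij ih =>
    rw [Finset.sum_Ico_succ_top hij]
    have h2 : 2 / (nthPrime j : ℝ) = 2 * (1 / nthPrime j) := by ring
    have h0 := center_nonneg j
    have hp : 0 < 1 / (nthPrime j : ℝ) := one_div_pos.2 (nthPrime_pos j)
    rcases center_succ j with ⟨h3, h4⟩ | ⟨h3, h4⟩ <;> rcases ih with ⟨h5, h6⟩ | h5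
    · exact Or.inl ⟨by linarith, by linarith⟩
    · exact Or.inr (by linarith)
    · exact Or.inr (by linarith)
    · exact Or.inr (by linarith)

/-- The primes have density zero. -/
theorem eventually_primeCounting_le_mul {ε : ℝ} (hε : 0 < ε) :
    ∀ᶠ n : ℕ in atTop, (Nat.primeCounting n : ℝ) ≤ ε * n := by
  have h1 := tendsto_natCast_atTop_atTop.eventually
    (Chebyshev.eventually_primeCounting_le (ε := 1) one_pos)
  have h2 := (Real.tendsto_log_atTop.comp tendsto_natCast_atTop_atTop).eventually
    (eventually_ge_atTop (((Real.log 4 + 1) / ε) : ℝ))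
  have h3 := (Real.tendsto_log_atTop.comp tendsto_natCast_atTop_atTop).eventually
    (eventually_gt_atTop (0 : ℝ))
  filter_upwards [h1, h2, h3] with n h1 h2 h3
  rw [Nat.floor_natCast] at h1
  refine h1.trans ?_
  simp only [Function.comp_apply] at h2 h3
  rw [div_le_iff₀ hε] at h2
  rw [div_le_iff₀ h3]
  nlinarith [Nat.cast_nonneg (α := ℝ) n]

/-- For large `Q` the reciprocals of the primes in `(Q, M Q]` have a small sum. -/
theorem eventually_sum_one_div_nthPrime_le (M : ℕ) {ε : ℝ} (hε : 0 < ε) :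
    ∀ᶠ Q : ℕ in atTop, ∀ i j, Q < nthPrime i → nthPrime j ≤ M * Q →
      ∑ k ∈ Finset.Ico i j, 1 / (nthPrime k : ℝ) ≤ ε := by
  rcases Nat.eq_zero_or_pos M with rfl | hM
  · filter_upwards with Q i j _ hj
    have := (Nat.prime_nth_prime j).pos
    simp only [nthPrime] at hj
    omega
  have hM' : (0 : ℝ) < M := by exact_mod_cast hM
  have hT : Tendsto (fun Q : ℕ => M * Q) atTop atTop := tendsto_id.const_mul_atTop' hM
  filter_upwards [hT.eventually (eventually_primeCounting_le_mul (div_pos hε hM')),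
    eventually_gt_atTop 0] with Q hQ hQ0 i j hi hj
  have hQ0' : (0 : ℝ) < Q := by exact_mod_cast hQ0
  have hterm : ∀ k ∈ Finset.Ico i j, 1 / (nthPrime k : ℝ) ≤ 1 / Q := fun k hk =>
    one_div_le_one_div_of_le hQ0' (by
      exact_mod_cast hi.le.trans (nthPrime_strictMono.monotone (Finset.mem_Ico.1 hk).1))
  have hj' : j ≤ Nat.primeCounting (M * Q) := by
    have h1 := Nat.monotone_primeCounting' (hj.trans (Nat.le_succ _))
    rwa [Nat.primeCounting'_nth_eq] at h1
  have hj'' : (j : ℝ) ≤ ε * Q := by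
    have h2 : (j : ℝ) ≤ Nat.primeCounting (M * Q) := by exact_mod_cast hj'
    refine (h2.trans hQ).trans (le_of_eq ?_)
    push_cast
    field_simp
  refine (Finset.sum_le_card_nsmul _ _ _ hterm).trans ?_
  rw [Nat.card_Ico, nsmul_eq_mul, mul_one_div, div_le_iff₀ hQ0']
  exact (Nat.cast_le.2 (Nat.sub_le _ _)).trans hj''

/-! ### Intervals that avoid the neighbourhoods of the centres -/

/-- An interval of radius `r` meets at most `r / δ + 3 / 2` of the intervals
`[t + 2 k δ, t + (2 k + 1) δ]`. -/
theorem card_filter_hit_le {r δ : ℝ} (hr : 0 ≤ r) (hδ : 0 < δ) (t θ : ℝ) (s : Finset ℕ)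
    (hs : ∀ k ∈ s, ∃ y ∈ Icc (t + 2 * k * δ) (t + 2 * k * δ + δ), |y - θ| ≤ r) :
    (s.card : ℝ) ≤ r / δ + 3 / 2 := by
  rcases s.eq_empty_or_nonempty with rfl | hne
  · rw [Finset.card_empty, Nat.cast_zero]
    positivity
  obtain ⟨y, hy, hyr⟩ := hs _ (s.min'_mem hne)
  obtain ⟨z, hz, hzr⟩ := hs _ (s.max'_mem hne)
  set a := s.min' hne
  set b := s.max' hne
  have hab : a ≤ b := s.min'_le_max' hne
  have hcard : s.card ≤ b + 1 - a := by
    rw [← Nat.card_Icc]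
    exact Finset.card_le_card fun k hk =>
      Finset.mem_Icc.2 ⟨s.min'_le k hk, s.le_max' k hk⟩
  have hcard' : (s.card : ℝ) ≤ b + 1 - a := by
    have h : ((b + 1 - a : ℕ) : ℝ) = b + 1 - a := by
      rw [Nat.cast_sub (by omega)]; push_cast; ring
    rw [← h]
    exact_mod_cast hcard
  have hdiff : (b - a - 1 / 2 : ℝ) * δ ≤ r := by
    have h1 := (abs_le.1 hyr).1
    have h2 := (abs_le.1 hzr).2
    have h3 := hy.2
    have h4 := hz.1
    linarith
  rw [← le_div_iff₀ hδ] at hdiff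
  linarith

/-- Let `ℓ = 1 / (10 Q)` and `I = [t, t + ℓ]`. At least `N` of the `10 N` intervals
`[t + 2 k δ, t + (2 k + 1) δ]` in `I`, with `δ = ℓ / (20 N)`, avoid the `1 / (60 p)`-neighbourhoods
of the centres belonging to the primes `p` in `(Q, 20 N Q]`; their indices `k` are collected in `G`.

All the centres that matter belong to the same run, because the primes in that range are too
sparse for a new run to get back to `I` (`hsparse`). So these centres are spaced by at least
`1 / p`, whence the sum of `1 / p` over all but the last of them is at most `4 ℓ / 3`. -/
theorem card_filter_avoid_ge {N Q : ℕ} (hN : 2 ≤ N) (hQ : 0 < Q)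
    (hsparse : ∀ i j, Q < nthPrime i → nthPrime j ≤ 20 * N * Q →
      ∑ k ∈ Finset.Ico i j, 1 / (nthPrime k : ℝ) ≤ 1 / 8)
    (t : ℝ) {δ : ℝ} (hδ : δ = 1 / (200 * N * Q)) {G : Finset ℕ}
    (hG : ∀ k < 10 * N, (∀ n, Q < nthPrime n → nthPrime n ≤ 20 * N * Q →
      ∀ y ∈ Icc (t + 2 * k * δ) (t + 2 * k * δ + δ), 1 / 60 / (nthPrime n : ℝ) < |y - center n|) →
      k ∈ G) :
    N ≤ G.card := by
  classical
  have hN0 : (2 : ℝ) ≤ N := by exact_mod_cast hN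
  have hQ1 : (1 : ℝ) ≤ Q := by exact_mod_cast hQ
  have hδ0 : 0 < δ := by rw [hδ]; positivity
  have hQinv : 1 / (Q : ℝ) = 200 * N * δ := by rw [hδ]; field_simp
  have hQinv1 : 1 / (Q : ℝ) ≤ 1 := by rw [div_le_one (by linarith)]; exact hQ1
  let hit : ℕ → ℕ → Prop := fun n k =>
    ∃ y ∈ Icc (t + 2 * k * δ) (t + 2 * k * δ + δ), |y - center n| ≤ 1 / 60 / (nthPrime n : ℝ)
  let B : ℕ → Finset ℕ := fun n => (Finset.range (10 * N)).filter (hit n)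
  -- the indices of the primes in the range whose neighbourhoods meet one of the intervals
  let S : Finset ℕ := (Finset.range (20 * N * Q + 1)).filter fun n =>
    Q < nthPrime n ∧ nthPrime n ≤ 20 * N * Q ∧ (B n).Nonempty
  have hcover : Finset.range (10 * N) ⊆ G ∪ S.biUnion B := by
    intro k hk
    by_cases hkG : k ∈ G
    · exact Finset.mem_union_left _ hkG
    have hk' := mt (hG k (Finset.mem_range.1 hk)) hkG
    push Not at hk'
    obtain ⟨n, h1, h2, y, hy, hyn⟩ := hk'
    have hkB : k ∈ B n := Finset.mem_filter.2 ⟨hk, y, hy, hyn⟩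
    refine Finset.mem_union_right _ (Finset.mem_biUnion.2 ⟨n, Finset.mem_filter.2
      ⟨Finset.mem_range.2 ?_, h1, h2, k, hkB⟩, hkB⟩)
    have := nthPrime_strictMono.le_apply (x := n)
    omega
  have hcard : 10 * N ≤ G.card + ∑ n ∈ S, (B n).card := by
    have h1 := Finset.card_le_card hcover
    rw [Finset.card_range] at h1
    have h2 := Finset.card_union_le G (S.biUnion B)
    have h3 := Finset.card_biUnion_le (s := S) (t := B)
    omega
  have hB : ∀ n, ((B n).card : ℝ) ≤ 1 / 60 * (1 / (nthPrime n : ℝ)) / δ + 3 / 2 := fun n => by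
    rw [mul_one_div]
    exact card_filter_hit_le (by positivity) hδ0 t (center n) _
      fun k hk => (Finset.mem_filter.1 hk).2
  have hupper : ∀ n ∈ S, 1 / (nthPrime n : ℝ) ≤ 200 * N * δ := fun n hn => by
    rw [← hQinv]
    have := (Finset.mem_filter.1 hn).2.1
    exact one_div_le_one_div_of_le (by linarith) (by exact_mod_cast this.le)
  have hlower : ∀ n ∈ S, 10 * δ ≤ 1 / (nthPrime n : ℝ) := fun n hn => by
    have h1 := (Finset.mem_filter.1 hn).2.2.1
    have h2 : (nthPrime n : ℝ) ≤ 20 * N * Q := by exact_mod_cast h1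
    have h3 := one_div_le_one_div_of_le (nthPrime_pos n) h2
    refine le_trans (le_of_eq ?_) h3
    rw [hδ]
    field_simp
    norm_num
  have hcenter : ∀ n ∈ S, t - 10 / 3 * N * δ ≤ center n ∧
      center n ≤ t + 20 * N * δ + 10 / 3 * N * δ := fun n hn => by
    obtain ⟨k, hk⟩ := (Finset.mem_filter.1 hn).2.2.2
    obtain ⟨hk1, y, hy, hyn⟩ := Finset.mem_filter.1 hk
    have h1 := hupper n hn
    rw [← mul_one_div] at hyn
    have hkN : (k : ℝ) + 1 ≤ 10 * N := by exact_mod_cast Finset.mem_range.1 hk1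
    have h2 := abs_le.1 hyn
    have h3 : ((k : ℝ) + 1) * δ ≤ 10 * N * δ := by gcongr
    have h4 : 0 ≤ (k : ℝ) * δ := by positivity
    rw [mem_Icc] at hy
    constructor <;> linarith
  have hsum : (∑ n ∈ S, (B n).card : ℝ) ≤ 70 / 9 * N + 3 / 2 := by
    rcases S.eq_empty_or_nonempty with hS | hne
    · rw [hS, Finset.sum_empty]
      positivity
    have ha := S.min'_mem hne
    have hb := S.max'_mem hne
    set a := S.min' hne
    set b := S.max' hne
    have hab : a ≤ b := S.min'_le_max' hne
    have hspread : ∑ n ∈ S.erase b, 1 / (nthPrime n : ℝ) ≤ 80 / 3 * N * δ := by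
      have hsub : S.erase b ⊆ Finset.Ico a b := fun n hn => by
        have h1 := Finset.mem_of_mem_erase hn
        exact Finset.mem_Ico.2 ⟨S.min'_le n h1,
          lt_of_le_of_ne (S.le_max' n h1) (Finset.ne_of_mem_erase hn)⟩
      have h1 := Finset.sum_le_sum_of_subset_of_nonneg (f := fun n => 1 / (nthPrime n : ℝ)) hsub
        fun n _ _ => (one_div_pos.2 (nthPrime_pos n)).le
      have h2 := hcenter a ha
      have h3 := hcenter b hb
      have h4 := hsparse a b (Finset.mem_filter.1 ha).2.1 (Finset.mem_filter.1 hb).2.2.1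
      rcases center_sub_center hab with ⟨h5, -⟩ | h5
      · linarith
      · -- a change of runs would put the two centres at distance at least `3 / 4`
        exfalso
        linarith
    -- Here `1 / p ≥ 10 δ`, so the summand `3 / 2` in `hB` is at most `3 / 20 * (1 / p) / δ`.
    have hrest : (∑ n ∈ S.erase b, (B n).card : ℝ) ≤ 40 / 9 * N := by
      calc (∑ n ∈ S.erase b, (B n).card : ℝ)
          ≤ ∑ n ∈ S.erase b, 1 / 6 * (1 / (nthPrime n : ℝ)) / δ := by
            refine Finset.sum_le_sum fun n hn => (hB n).trans ?_
            have h1 := hlower n (Finset.mem_of_mem_erase hn)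
            have h2 : (3 / 2 : ℝ) ≤ 3 / 20 * (1 / (nthPrime n : ℝ)) / δ := by
              rw [le_div_iff₀ hδ0]
              linarith
            refine (add_le_add_right h2 _).trans (le_of_eq ?_)
            ring
        _ = 1 / 6 * (∑ n ∈ S.erase b, 1 / (nthPrime n : ℝ)) / δ := by
            rw [Finset.mul_sum, Finset.sum_div]
        _ ≤ 1 / 6 * (80 / 3 * N * δ) / δ := by gcongr
        _ = 40 / 9 * N := by field_simp; norm_num
    -- The neighbourhood of the last centre has length at most `ℓ / 3`, but the gap that follows it
    -- need not lie in `I`, so it is counted on its own.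
    have hlast : ((B b).card : ℝ) ≤ 10 / 3 * N + 3 / 2 := by
      refine (hB b).trans (add_le_add_left ?_ _)
      rw [div_le_iff₀ hδ0]
      have := hupper b hb
      linarith
    rw [← Finset.add_sum_erase S (fun n => ((B n).card : ℝ)) hb]
    linarith
  have hcard' : (10 * N : ℝ) ≤ G.card + ∑ n ∈ S, ((B n).card : ℝ) := by exact_mod_cast hcard
  have : (N : ℝ) ≤ G.card := by linarith
  exact_mod_cast this

/-! ### The dimension of the exceptional set -/

/-- The tree of intervals for a fixed `N`: an interval of level `n` avoids the
`1 / (60 p)`-neighbourhoods of the centres for all primes `p` in `(P, P * (20 N) ^ n]`. -/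
theorem log_div_log_le_dimH_compl_approxSetWith {N : ℕ} (hN : 2 ≤ N) {c : ℝ} (hc : c ≤ 1 / 60) :
    ENNReal.ofReal (Real.log N / Real.log (20 * N)) ≤
      dimH (Icc (0 : ℝ) 1 \ approxSetWith greedySeq c) := by
  obtain ⟨P, hP⟩ := eventually_atTop.1
    ((eventually_sum_one_div_nthPrime_le (20 * N) (ε := 1 / 8) (by norm_num)).and
      (eventually_gt_atTop 0))
  have hP0 : 0 < P := (hP P le_rfl).2
  have hP0' : (1 : ℝ) ≤ P := by exact_mod_cast hP0
  have hN0 : (2 : ℝ) ≤ N := by exact_mod_cast hN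
  have hM : ((20 * N : ℕ) : ℝ) = 20 * N := by push_cast; rfl
  rw [← hM]
  set M := 20 * N with hMdef
  let Good : ℕ → ℝ → Prop := fun n t => 0 ≤ t ∧ t + 1 / (10 * P) / (M : ℝ) ^ n ≤ 1 ∧
    ∀ i, P < nthPrime i → nthPrime i ≤ P * M ^ n →
      ∀ y ∈ Icc t (t + 1 / (10 * P) / (M : ℝ) ^ n), 1 / 60 / (nthPrime i : ℝ) < |y - center i|
  refine log_div_log_le_dimH (ℓ₀ := 1 / (10 * P)) (Good := Good) (t₀ := 0) hN (by omega)
    (by positivity) ⟨le_rfl, ?_, ?_⟩ ?_ ?_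
  · rw [pow_zero, div_one, zero_add, div_le_one (by positivity)]
    linarith
  · intro i h1 h2
    rw [pow_zero, mul_one] at h2
    omega
  · rintro n t ⟨ht0, ht1, ht⟩
    have hMpos : 0 < M := by omega
    have hQ : P ≤ P * M ^ n := Nat.le_mul_of_pos_right _ (by positivity)
    set δ : ℝ := 1 / (10 * P) / (M : ℝ) ^ (n + 1) with hδ
    have hδ0 : 0 < δ := by positivity
    have hℓ : 1 / (10 * P) / (M : ℝ) ^ n = 20 * N * δ := by
      rw [hδ, pow_succ, ← hM]
      field_simp
    rw [hℓ] at ht1 ht ⊢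
    classical
    let G : Finset ℕ := (Finset.range (10 * N)).filter fun k : ℕ =>
      ∀ i, P * M ^ n < nthPrime i → nthPrime i ≤ 20 * N * (P * M ^ n) →
        ∀ y ∈ Icc (t + 2 * (k : ℝ) * δ) (t + 2 * k * δ + δ),
          1 / 60 / (nthPrime i : ℝ) < |y - center i|
    have hG : N ≤ G.card :=
      card_filter_avoid_ge hN (hP0.trans_le hQ) (hP _ hQ).1 t
        (by rw [hδ, pow_succ, Nat.cast_mul P, Nat.cast_pow M, hM]; field_simp; norm_num)
        fun k hk h => Finset.mem_filter.2 ⟨Finset.mem_range.2 hk, h⟩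
    refine ⟨fun i => t + 2 * (G.orderEmbOfCardLe hG i : ℕ) * δ, fun i => ?_⟩
    have hi := Finset.mem_filter.1 (G.orderEmbOfCardLe_mem hG i)
    have hk : ((G.orderEmbOfCardLe hG i : ℕ) : ℝ) + 1 ≤ 10 * N := by
      exact_mod_cast Finset.mem_range.1 hi.1
    have hij : ∀ j, i ≠ j →
        (G.orderEmbOfCardLe hG i : ℕ) ≠ (G.orderEmbOfCardLe hG j : ℕ) :=
      fun j hne h => hne ((G.orderEmbOfCardLe hG).injective h)
    set k : ℕ := G.orderEmbOfCardLe hG i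
    have hkδ : 0 ≤ (k : ℝ) * δ := by positivity
    have hkδ' : ((k : ℝ) + 1) * δ ≤ 10 * N * δ := by gcongr
    refine ⟨⟨by linarith, by linarith, ?_⟩, by linarith, by linarith, ?_⟩
    · intro m h1 h2 y hy
      rcases le_or_gt (nthPrime m) (P * M ^ n) with h3 | h3
      · rw [mem_Icc] at hy
        exact ht m h1 h3 y ⟨by linarith, by linarith⟩
      · refine hi.2 m h3 (h2.trans (le_of_eq ?_)) y hy
        rw [pow_succ, hMdef]
        ring
    · intro j hne
      have h1 := hij j hne
      set k' : ℕ := G.orderEmbOfCardLe hG j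
      have h2 : (1 : ℝ) ≤ |(k : ℝ) - k'| := by
        have h3 : (1 : ℤ) ≤ |(k : ℤ) - k'| := Int.one_le_abs (by omega)
        exact_mod_cast h3
      rw [show t + 2 * (k : ℝ) * δ - (t + 2 * k' * δ) = (k - k') * (2 * δ) by ring, abs_mul,
        abs_of_pos (by linarith : 0 < 2 * δ)]
      exact le_mul_of_one_le_left (by linarith) h2
  · intro x hx
    refine ⟨?_, fun hxc => ?_⟩
    · obtain ⟨t, ⟨h1, h2, -⟩, h3⟩ := hx 0
      exact ⟨h1.trans h3.1, h3.2.trans h2⟩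
    · have hfreq := (mem_approxSetWith_greedySeq.1 hxc).2
      obtain ⟨i, hi1, hi2⟩ := (hfreq.and_eventually
        (nthPrime_strictMono.tendsto_atTop.eventually (eventually_gt_atTop P))).exists
      have hlt : nthPrime i < M ^ nthPrime i := Nat.lt_pow_self (by omega)
      obtain ⟨t, ⟨-, -, ht⟩, hxt⟩ := hx (nthPrime i)
      have h1 := ht i hi2 (hlt.le.trans (Nat.le_mul_of_pos_left _ hP0)) x hxt
      have h2 : c / (nthPrime i : ℝ) ≤ 1 / 60 / nthPrime i := by gcongr
      linarith

theorem dimH_compl_approxSetWith_greedySeq {c : ℝ} (hc : c ≤ 1 / 60) :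
    dimH (Icc (0 : ℝ) 1 \ approxSetWith greedySeq c) = 1 := by
  refine le_antisymm ((dimH_mono (subset_univ _)).trans Real.dimH_univ.le) ?_
  have hlog : Tendsto (fun N : ℕ => Real.log N) atTop atTop :=
    Real.tendsto_log_atTop.comp tendsto_natCast_atTop_atTop
  have hlim : Tendsto (fun N : ℕ => Real.log N / Real.log (20 * N)) atTop (𝓝 1) := by
    have h1 : Tendsto (fun N : ℕ => 1 - Real.log 20 / (Real.log 20 + Real.log N)) atTop
        (𝓝 (1 - 0)) :=
      tendsto_const_nhds.sub
        (tendsto_const_nhds.div_atTop (tendsto_atTop_add_const_left _ _ hlog))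
    rw [sub_zero] at h1
    refine h1.congr' ?_
    filter_upwards [eventually_gt_atTop 0] with N hN
    have hN' : (1 : ℝ) ≤ N := by exact_mod_cast hN
    have h2 : 0 < Real.log 20 + Real.log N :=
      add_pos_of_pos_of_nonneg (Real.log_pos (by norm_num)) (Real.log_nonneg hN')
    rw [Real.log_mul (by norm_num) (by positivity)]
    field_simp
    ring
  have hlim' := (ENNReal.continuous_ofReal.tendsto 1).comp hlim
  rw [ENNReal.ofReal_one] at hlim'
  refine le_of_tendsto hlim' ?_
  filter_upwards [eventually_ge_atTop 2] with N hN
  exact log_div_log_le_dimH_compl_approxSetWith hN hc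

end PrimeApprox

theorem mainTheorem4 :
    (∀ p₀ : ℕ, p₀.Prime → PrimeApprox.CoverTerminates p₀) ∧
    PrimeApprox.greedySeq ∈ PrimeApprox.Omega ∧
    (∀ c : ℝ, 2 < c →
      PrimeApprox.approxSetWith PrimeApprox.greedySeq c = Set.Icc (0 : ℝ) 1) ∧
    MeasureTheory.volume (PrimeApprox.approxSet PrimeApprox.greedySeq) = 1 ∧
    (∀ c : ℝ, 0 < c → c < 1 / 60 →
      dimH (Set.Icc (0 : ℝ) 1 \ PrimeApprox.approxSetWith PrimeApprox.greedySeq c) = 1) :=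
  ⟨fun _ h => PrimeApprox.coverTerminates h, PrimeApprox.greedySeq_mem_Omega,
    fun _ h => PrimeApprox.approxSetWith_greedySeq_eq_Icc h.le,
    PrimeApprox.volume_approxSet_greedySeq,
    fun _ _ h => PrimeApprox.dimH_compl_approxSetWith_greedySeq h.le⟩
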